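/- Let $\underline{\mu}=(\mu_x,\mu_y)\in\mathbb{R}^2$ and $0\le\eta<+\infty$ be constants, let $\underline{\mathbb{W}}_i$ be a standard two-dimensional Wiener process, and let the channel vector $\underline{h}_i(t)=(x_i(t),y_i(t))$, $t\ge 0$, be a continuous process solving the Ornstein–Uhlenbeck equation $$\mathrm{d}\underline{h}_i(t)=\tfrac12\bigl(\underline{\mu}-\underline{h}_i(t)\bigr)\,\mathrm{d}t+\eta\,\mathrm{d}\underline{\mathbb{W}}_i(t),$$ with initial value $\underline{h}_i(0)$ independent of $\underline{\mathbb{W}}_i$ (for example deterministic). (1) If $\mathbb{E}[|\underline{h}_i(0)|^2]<\infty$, then $\mathbb{E}[|\underline{h}_i(t)|^2]<\infty$ for all $t\ge0$ and $$\lim_{t\to+\infty}\mathbb{E}[\underline{h}_i(t)]=\underline{\mu},\qquad \lim_{t\to+\infty}\Bigl(\mathbb{E}\bigl[|\underline{h}_i(t)|^2\bigr]-\bigl|\mathbb{E}[\underline{h}_i(t)]\bigr|^2\Bigr)=2\eta^2 .$$ (2) If $\eta>0$, the stationary probability density functions of the components $x_i$ and $y_i$ are $$m_x(x)=\frac{1}{\eta\sqrt{2\pi}}\,e^{-\frac{(x-\mu_x)^2}{2\eta^2}},\qquad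 m_y(y)=\frac{1}{\eta\sqrt{2\pi}}\,e^{-\frac{(y-\mu_y)^2}{2\eta^2}} .$$ That is, if $x_i(0)$ has density $m_x$, then $x_i(t)$ has density $m_x$ for every $t\ge0$; conversely, if the law of $x_i(t)$ does not depend on $t\ge 0$, then this law has density $m_x$; and likewise for $y_i$ and $m_y$. -/

import Mathlib

open MeasureTheory ProbabilityTheory Filter Topology
open scoped NNReal ENNReal

/-- `W` is a `d`-dimensional (standard) Wiener process on `(Ω, P)`: a process whose coordinates
are independent one-dimensional Brownian motions. -/
structure IsWienerProcess {Ω : Type*} [MeasurableSpace Ω] {d : ℕ}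
    (W : ℝ≥0 → Ω → EuclideanSpace ℝ (Fin d)) (P : Measure Ω) : Prop where
  measurable : ∀ t, Measurable (W t)
  brownian : ∀ j, IsBrownianReal (fun t ω => W t ω j) P
  indep : iIndepFun (fun (j : Fin d) (ω : Ω) (t : ℝ≥0) => W t ω j) P

/-- `h` is a solution of the stochastic differential equation
`dh(t) = ½ (μ - h(t)) dt + η dW(t)`, `t ≥ 0`, in the plane, driven by the two-dimensional Wiener
process `W`: a process with continuous paths, whose initial value does not anticipate the noise,
and which almost surely satisfies the integral form of the equation for all times. The diffusion
coefficient `η` is constant and `W 0 = 0` almost surely, so that `∫₀ᵗ η dW = η W(t)`. -/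
structure IsChannelProcess {Ω : Type*} [MeasurableSpace Ω]
    (μ : EuclideanSpace ℝ (Fin 2)) (η : ℝ)
    (W h : ℝ≥0 → Ω → EuclideanSpace ℝ (Fin 2)) (P : Measure Ω) : Prop where
  wiener : IsWienerProcess W P
  measurable : ∀ t, Measurable (h t)
  indep_init : IndepFun (h 0) (fun (ω : Ω) (t : ℝ≥0) => W t ω) P
  continuous_paths : ∀ᵐ ω ∂P, Continuous (fun t => h t ω)
  equation : ∀ᵐ ω ∂P, ∀ t : ℝ≥0,
    h t ω = h 0 ω + (∫ s in (0 : ℝ)..(t : ℝ), (1 / 2 : ℝ) • (μ - h s.toNNReal ω)) + η • W t ω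

/-- The function `x ↦ 1 / (η √(2π)) · exp (-(x - m)² / (2 η²))`. -/
noncomputable def channelDensity (m η x : ℝ) : ℝ :=
  1 / (η * Real.sqrt (2 * Real.pi)) * Real.exp (-(x - m) ^ 2 / (2 * η ^ 2))

/-- The real random variable `X` has the probability density function `f` (with respect to
Lebesgue measure) under `P`. -/
def HasDensity {Ω : Type*} [MeasurableSpace Ω] (X : Ω → ℝ) (f : ℝ → ℝ) (P : Measure Ω) : Prop :=
  AEMeasurable X P ∧ Measurable f ∧ (∀ x, 0 ≤ f x) ∧
    P.map X = volume.withDensity (fun x => ENNReal.ofReal (f x))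

/-!
The drift is linear and the noise additive, so the equation can be solved path by path. Variation
of constants gives, for each component,
`x(t) = m + e^{-t/2} (x(0) - m) + η N(t)`, where `N(t) = ∫₀ᵗ e^{-(t-s)/2} dw(s)` is understood
through integration by parts as `w(t) - ½ ∫₀ᵗ e^{-(t-s)/2} w(s) ds`; no stochastic integral is
needed (`eq_add_ouNoise_of_equation`).

Along each continuous path, `N(t)` is the limit of the Riemann–Stieltjes sums
`∑ e^{-(t-s_k)/2} (w(s_{k+1}) - w(s_k))` (`tendsto_ouSum`). This has two consequences. The sums are
centred Gaussian, as the increments are independent, and their variances are Riemann sums of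
`∫₀ᵗ e^{-(t-s)} ds`; hence `N(t)` has the law `N(0, 1 - e^{-t})` (`hasLaw_ouNoise`). And the sums
are measurable functions of the path for the product σ-algebra, so `N(t)` is independent of the
initial value (`IsChannelProcess.indepFun_ouNoise`).

The moments follow from the independent decomposition: the mean is `m + e^{-t/2} (E x(0) - m)`, the
variance `e^{-t} Var x(0) + η² (1 - e^{-t})`, and `E|h|² - |E h|²` is the sum of the variances of the
two components. If `x(0)` has the law `N(m, η²)`, then `x(t)` is a sum of
independent Gaussian variables with total mean `m` and variance `e^{-t} η² + η² (1 - e^{-t}) = η²`.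
Conversely the characteristic function of a time-independent law is, for every `t`, the product
of those of `m + e^{-t/2} (x(0) - m)` and `η N(t)`, which converge to those of the constant `m` and
of `N(0, η²)` as `t → ∞`.
-/

/-! ### Riemann–Stieltjes sums -/

/-- Riemann–Stieltjes sums along the uniform subdivisions of `[0, t]`, with arbitrary tags,
converge when the integrator is continuously differentiable. -/
lemma tendsto_sum_mul_sub {t : ℝ} (ht : 0 ≤ t) {f g g' : ℝ → ℝ} (hf : Continuous f)
    (hg : ∀ x, HasDerivAt g (g' x) x) (hg' : Continuous g') {c : ℕ → ℕ → ℝ}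
    (hc : ∀ n k : ℕ, k < n → c n k ∈ Set.Icc (t * k / n) (t * (k + 1 : ℕ) / n)) :
    Tendsto (fun n : ℕ => ∑ k ∈ Finset.range n,
        f (c n k) * (g (t * (k + 1 : ℕ) / n) - g (t * k / n)))
      atTop (𝓝 (∫ s in (0 : ℝ)..t, f s * g' s)) := by
  obtain ⟨C, hC⟩ := isCompact_Icc.exists_bound_of_continuousOn (s := Set.Icc 0 t) hg'.continuousOn
  have hC0 : 0 ≤ C := (norm_nonneg _).trans (hC 0 ⟨le_rfl, ht⟩)
  have huc := isCompact_Icc.uniformContinuousOn_of_continuous (s := Set.Icc 0 t) hf.continuousOn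
  rw [Metric.uniformContinuousOn_iff] at huc
  rw [Metric.tendsto_atTop]
  intro ε hε
  have hD : 0 < C * t + 1 := by positivity
  obtain ⟨δ, hδ, huc⟩ := huc (ε / (C * t + 1)) (by positivity)
  obtain ⟨N, hN⟩ := exists_nat_gt (t / δ)
  refine ⟨N + 1, fun n hn => ?_⟩
  have hn0 : (0 : ℝ) < n := by exact_mod_cast (Nat.succ_pos N).trans_le hn
  have hmesh : t / n < δ := by
    rw [div_lt_iff₀ hδ] at hN
    rw [div_lt_iff₀ hn0]
    have : (N : ℝ) ≤ n := by exact_mod_cast (Nat.le_succ N).trans hn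
    nlinarith
  set a : ℕ → ℝ := fun k => t * k / n with ha
  have hstep : ∀ k, a (k + 1) - a k = t / n := fun k => by
    simp only [ha]; push_cast; ring
  have hmono : Monotone a := monotone_nat_of_le_succ fun k => by
    have := hstep k
    have : 0 ≤ t / n := by positivity
    linarith
  have ha0 : a 0 = 0 := by simp [ha]
  have han : a n = t := by simp only [ha]; field_simp
  have hint : ∀ φ : ℝ → ℝ, Continuous φ → ∀ x y, IntervalIntegrable φ volume x y :=
    fun φ hφ x y => hφ.intervalIntegrable x y
  have hsum : ∫ s in (0 : ℝ)..t, f s * g' s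
      = ∑ k ∈ Finset.range n, ∫ s in a k..a (k + 1), f s * g' s := by
    rw [intervalIntegral.sum_integral_adjacent_intervals (f := fun s => f s * g' s) fun k _ =>
      hint _ (hf.mul hg') _ _, ha0, han]
  have hterm : ∀ k, f (c n k) * (g (a (k + 1)) - g (a k)) - ∫ s in a k..a (k + 1), f s * g' s
      = ∫ s in a k..a (k + 1), (f (c n k) - f s) * g' s := fun k => by
    rw [← intervalIntegral.integral_eq_sub_of_hasDerivAt (fun x _ => hg x) (hint _ hg' _ _),
      ← intervalIntegral.integral_const_mul, ← intervalIntegral.integral_sub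
        (hint _ (by fun_prop) _ _) (hint _ (by fun_prop) _ _)]
    simp only [sub_mul]
  change dist (∑ k ∈ Finset.range n, f (c n k) * (g (a (k + 1)) - g (a k))) _ < ε
  rw [hsum, Real.dist_eq, ← Finset.sum_sub_distrib, Finset.sum_congr rfl fun k _ => hterm k]
  have hbound : ∀ k ∈ Finset.range n,
      ‖∫ s in a k..a (k + 1), (f (c n k) - f s) * g' s‖ ≤ ε / (C * t + 1) * C * (t / n) := by
    intro k hk
    rw [Finset.mem_range] at hk
    have hle := hmono k.le_succ
    have hsub : Set.Icc (a k) (a (k + 1)) ⊆ Set.Icc 0 t :=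
      Set.Icc_subset_Icc (ha0 ▸ hmono k.zero_le) (han ▸ hmono hk)
    have := intervalIntegral.norm_integral_le_of_norm_le_const (a := a k) (b := a (k + 1))
      (C := ε / (C * t + 1) * C) (f := fun s => (f (c n k) - f s) * g' s) fun s hs => by
        rw [Set.uIoc_of_le hle] at hs
        have hs' := Set.Ioc_subset_Icc_self hs
        have hck : c n k ∈ Set.Icc (a k) (a (k + 1)) := hc n k hk
        rw [norm_mul]
        refine mul_le_mul ?_ (hC s (hsub hs')) (norm_nonneg _) (by positivity)
        rw [← dist_eq_norm]
        refine (huc _ (hsub hck) _ (hsub hs') ?_).le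
        refine (Real.dist_le_of_mem_Icc hck hs').trans_lt ?_
        rwa [hstep]
    rwa [hstep, abs_of_nonneg (by positivity)] at this
  calc |∑ k ∈ Finset.range n, ∫ s in a k..a (k + 1), (f (c n k) - f s) * g' s|
      ≤ ∑ k ∈ Finset.range n, ε / (C * t + 1) * C * (t / n) := norm_sum_le_of_le _ hbound
    _ = ε * (C * t / (C * t + 1)) := by
        rw [Finset.sum_const, Finset.card_range, nsmul_eq_mul]; field_simp
    _ < ε := by
        rw [mul_lt_iff_lt_one_right hε, div_lt_one hD]
        linarith

/-! ### The equation along one path -/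

/-- The value at time `t` of the stochastic convolution `∫₀ᵗ e^{-(t-s)/2} dw(s)`, for a path `w`
with `w 0 = 0`. Integration by parts turns it into an ordinary integral, which makes sense for
every continuous path. -/
noncomputable def ouNoise (t : ℝ≥0) (w : ℝ≥0 → ℝ) : ℝ :=
  w t - ∫ s in (0 : ℝ)..t, w s.toNNReal * (1 / 2 * Real.exp (-(t - s) / 2))

/-- The Riemann–Stieltjes sum of `∫₀ᵗ e^{-(t-s)/2} dw(s)` along the subdivision of `[0, t]` into
`n` equal parts, tagged on the left. -/
noncomputable def ouSum (t : ℝ≥0) (n : ℕ) (w : ℝ≥0 → ℝ) : ℝ :=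
  ∑ k ∈ Finset.range n, Real.exp (-(t - t * k / n) / 2) *
    (w (t * (k + 1 : ℕ) / n) - w (t * k / n))

lemma hasDerivAt_exp_half (t x : ℝ) :
    HasDerivAt (fun s => Real.exp (-(t - s) / 2)) (1 / 2 * Real.exp (-(t - x) / 2)) x := by
  have h : HasDerivAt (fun s : ℝ => -(t - s) / 2) (1 / 2) x := by
    simpa using (((hasDerivAt_id x).const_sub t).neg).div_const 2
  simpa [mul_comm] using h.exp

lemma tendsto_ouSum {w : ℝ≥0 → ℝ} (hw : Continuous w) (hw0 : w 0 = 0) (t : ℝ≥0) :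
    Tendsto (fun n => ouSum t n w) atTop (𝓝 (ouNoise t w)) := by
  have hlim := tendsto_sum_mul_sub t.coe_nonneg (f := fun s => w s.toNNReal)
    (hw.comp continuous_real_toNNReal) (hasDerivAt_exp_half t) (by fun_prop)
    (c := fun n k => t * (k + 1 : ℕ) / n)
    (fun n k _ => ⟨by gcongr; exact k.le_succ, le_rfl⟩)
  refine (hlim.const_sub (w t)).congr' ?_
  filter_upwards [eventually_gt_atTop 0] with n hn
  have hn0 : (n : ℝ≥0) ≠ 0 := by exact_mod_cast hn.ne'
  have hcast : ∀ k : ℕ, ((t : ℝ) * k / n).toNNReal = t * k / n := fun k => by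
    rw [← NNReal.coe_natCast k, ← NNReal.coe_natCast n, ← NNReal.coe_mul, ← NNReal.coe_div,
      Real.toNNReal_coe]
  -- summation by parts
  have htel := Finset.sum_range_sub
    (fun k : ℕ => Real.exp (-(t - t * k / n) / 2) * w (t * k / n)) n
  have h1 : t * (n : ℝ≥0) / n = t := by field_simp
  have h2 : (t : ℝ) * n / n = t := by exact_mod_cast congrArg NNReal.toReal h1
  simp only [h1, h2, CharP.cast_eq_zero, mul_zero, zero_div, hw0, sub_self, neg_zero,
    Real.exp_zero, one_mul, sub_zero] at htel
  simp only [hcast, ouSum]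
  rw [← htel, ← Finset.sum_sub_distrib]
  exact Finset.sum_congr rfl fun k _ => by ring

/-- Variation of constants for `x' = ½ (m - x) + η w'`. -/
lemma eq_add_ouNoise_of_equation {x w : ℝ≥0 → ℝ} {m η : ℝ} (hx : Continuous x)
    (hw : Continuous w)
    (heq : ∀ t : ℝ≥0,
      x t = x 0 + (∫ s in (0 : ℝ)..t, 1 / 2 * (m - x s.toNNReal)) + η * w t) (t : ℝ≥0) :
    x t = m + Real.exp (-t / 2) * (x 0 - m) + η * ouNoise t w := by
  have hxc : Continuous fun s : ℝ => x s.toNNReal := hx.comp continuous_real_toNNReal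
  have hwc : Continuous fun s : ℝ => w s.toNNReal := hw.comp continuous_real_toNNReal
  set I : ℝ → ℝ := fun r => ∫ s in (0 : ℝ)..r, 1 / 2 * (m - x s.toNNReal) with hI
  have hId : ∀ r, HasDerivAt I (1 / 2 * (m - x r.toNNReal)) r := fun r =>
    intervalIntegral.integral_hasDerivAt_right
      ((by fun_prop : Continuous fun s : ℝ => 1 / 2 * (m - x s.toNNReal)).intervalIntegrable _ _)
      ((by fun_prop : Continuous fun s : ℝ =>
        1 / 2 * (m - x s.toNNReal)).stronglyMeasurableAtFilter _ _)
      (by fun_prop)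
  -- the drift `I` solves a linear equation with integrating factor `e^{-(t-s)/2}`
  have hd : ∀ r ∈ Set.uIcc (0 : ℝ) t,
      HasDerivAt (fun s => I s * Real.exp (-(t - s) / 2))
        ((m - x 0) * (1 / 2 * Real.exp (-(t - r) / 2))
          - η * (w r.toNNReal * (1 / 2 * Real.exp (-(t - r) / 2)))) r := fun r hr => by
    rw [Set.uIcc_of_le t.coe_nonneg] at hr
    have hr' := heq r.toNNReal
    rw [Real.coe_toNNReal _ hr.1] at hr'
    change x r.toNNReal = x 0 + I r + η * w r.toNNReal at hr'
    refine ((hId r).mul (hasDerivAt_exp_half t r)).congr_deriv ?_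
    rw [hr']
    ring
  have hftc := intervalIntegral.integral_eq_sub_of_hasDerivAt hd
    (Continuous.intervalIntegrable (by fun_prop) _ _)
  have hexp := intervalIntegral.integral_eq_sub_of_hasDerivAt (a := 0) (b := (t : ℝ))
    (fun r _ => hasDerivAt_exp_half t r) (Continuous.intervalIntegrable (by fun_prop) _ _)
  rw [intervalIntegral.integral_sub (Continuous.intervalIntegrable (by fun_prop) _ _)
    (Continuous.intervalIntegrable (by fun_prop) _ _), intervalIntegral.integral_const_mul, hexp,
    intervalIntegral.integral_const_mul] at hftc
  have hI0 : I 0 = 0 := by simp [hI]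
  simp only [hI0, sub_self, neg_zero, zero_div, Real.exp_zero, mul_one, zero_mul, sub_zero] at hftc
  have ht := heq t
  change x t = x 0 + I t + η * w t at ht
  rw [ht, ← hftc, ouNoise]
  ring

/-! ### The law of the stochastic convolution -/

section Law

variable {Ω : Type*} [MeasurableSpace Ω] {P : Measure Ω}

lemma tendsto_charFun_map_of_ae_tendsto [IsProbabilityMeasure P] {ι : Type*} {l : Filter ι}
    [l.IsCountablyGenerated] {X : ι → Ω → ℝ} {Y : Ω → ℝ} (hX : ∀ i, AEMeasurable (X i) P)
    (hY : AEMeasurable Y P) (h : ∀ᵐ ω ∂P, Tendsto (fun i => X i ω) l (𝓝 (Y ω))) (u : ℝ) :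
    Tendsto (fun i => charFun (P.map (X i)) u) l (𝓝 (charFun (P.map Y) u)) := by
  have hcont : Continuous fun x : ℝ => Complex.exp (u * x * Complex.I) := by fun_prop
  have key : ∀ Z : Ω → ℝ, AEMeasurable Z P →
      charFun (P.map Z) u = ∫ ω, Complex.exp (u * Z ω * Complex.I) ∂P := fun Z hZ => by
    rw [charFun_apply_real, integral_map hZ hcont.aestronglyMeasurable]
  simp_rw [fun i => key _ (hX i), key _ hY]
  refine tendsto_integral_filter_of_dominated_convergence (fun _ => (1 : ℝ))
    (.of_forall fun i => hcont.measurable.comp_aemeasurable (hX i) |>.aestronglyMeasurable)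
    (.of_forall fun i => ae_of_all _ fun ω => ?_) (integrable_const _) ?_
  · rw [← Complex.ofReal_mul, Complex.norm_exp_ofReal_mul_I]
  · filter_upwards [h] with ω hω
    exact (hcont.tendsto _).comp hω

lemma measurable_ouSum (t : ℝ≥0) (n : ℕ) : Measurable (ouSum t n) := by
  unfold ouSum
  fun_prop

lemma charFun_map_ouSum [IsProbabilityMeasure P] {B : ℝ≥0 → Ω → ℝ} (hB : IsBrownianReal B P)
    (t : ℝ≥0) (n : ℕ) (u : ℝ) :
    charFun (P.map fun ω => ouSum t n (B · ω)) u
      = Complex.exp (-(u ^ 2 / 2 * ∑ k ∈ Finset.range n, Real.exp (-(t - t * k / n)) *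
          (t * (k + 1 : ℕ) / n - t * k / n) : ℝ)) := by
  have hm : Monotone fun k : ℕ => t * k / n := fun i j hij => by
    dsimp only
    gcongr
  have hind := hB.hasIndepIncrements.nat hm
  have hind' := hind.comp (fun k x => Real.exp (-(t - t * k / n) / 2) * x) fun k => by fun_prop
  have hae : ∀ k : ℕ, AEMeasurable
      (fun ω => B (t * (k + 1 : ℕ) / n) ω - B (t * k / n) ω) P := fun k =>
    (hB.aemeasurable _).sub (hB.aemeasurable _)
  simp only [ouSum]
  have := iIndepFun.charFun_map_fun_finsetSum_eq_prod (P := P) (s := Finset.range n)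
    (X := fun (k : ℕ) ω => Real.exp (-(t - t * k / n) / 2) *
      (B (t * (k + 1 : ℕ) / n) ω - B (t * k / n) ω))
    (fun k _ => (hae k).const_mul _) (hind'.restrict _)
  refine (congrFun this u).trans ?_
  rw [Finset.prod_apply, Finset.mul_sum, Complex.ofReal_sum, ← Finset.sum_neg_distrib,
    Complex.exp_sum]
  refine Finset.prod_congr rfl fun k _ => ?_
  refine (charFun_map_mul_comp (hae k) _ _).trans ?_
  obtain ⟨v, hlaw, hv⟩ : ∃ v : ℝ≥0,
      P.map (fun ω => B (t * (k + 1 : ℕ) / n) ω - B (t * k / n) ω) = gaussianReal 0 v ∧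
        (v : ℝ) = t * (k + 1 : ℕ) / n - t * k / n := by
    refine ⟨_, (hB.hasLaw_sub (t * (k + 1 : ℕ) / n) (t * k / n)).map_eq, ?_⟩
    change dist ((t * (k + 1 : ℕ) / n : ℝ≥0) : ℝ) ((t * k / n : ℝ≥0) : ℝ) = _
    rw [Real.dist_eq, abs_of_nonneg (sub_nonneg.2 (NNReal.coe_le_coe.2 (hm k.le_succ)))]
    push_cast
    ring
  have hsq : Real.exp (-(t - t * k / n)) = Real.exp (-(t - t * k / n) / 2) ^ 2 := by
    rw [← Real.exp_nat_mul]; congr 1; push_cast; ring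
  rw [hlaw, charFun_gaussianReal, ← hv, hsq]
  congr 1
  push_cast
  ring

lemma ae_tendsto_ouSum {B : ℝ≥0 → Ω → ℝ} (hB : IsBrownianReal B P) (t : ℝ≥0) :
    ∀ᵐ ω ∂P, Tendsto (fun n => ouSum t n (B · ω)) atTop (𝓝 (ouNoise t (B · ω))) := by
  filter_upwards [hB.cont, hB.eval_zero_ae_eq_zero] with ω hω h0
  exact tendsto_ouSum hω h0 t

lemma aemeasurable_ouSum {B : ℝ≥0 → Ω → ℝ} (hB : ∀ t, AEMeasurable (B t) P) (t : ℝ≥0) (n : ℕ) :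
    AEMeasurable (fun ω => ouSum t n (B · ω)) P := by
  unfold ouSum
  fun_prop

/-- The sums `ouSum` are Gaussian because the increments are independent, with variances that are
Riemann sums of `∫₀ᵗ e^{-(t-s)} ds`; characteristic functions carry this to the limit. -/
lemma hasLaw_ouNoise [IsProbabilityMeasure P] {B : ℝ≥0 → Ω → ℝ} (hB : IsBrownianReal B P)
    (t : ℝ≥0) :
    HasLaw (fun ω => ouNoise t (B · ω)) (gaussianReal 0 (1 - Real.exp (-t)).toNNReal) P := by
  have hS := aemeasurable_ouSum hB.aemeasurable t
  have hN : AEMeasurable (fun ω => ouNoise t (B · ω)) P :=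
    aemeasurable_of_tendsto_metrizable_ae atTop hS (ae_tendsto_ouSum hB t)
  refine ⟨hN, ?_⟩
  have := Measure.isProbabilityMeasure_map (μ := P) hN
  refine Measure.ext_of_charFun (funext fun u => ?_)
  refine tendsto_nhds_unique
    (tendsto_charFun_map_of_ae_tendsto hS hN (ae_tendsto_ouSum hB t) u) ?_
  have hd : ∀ r, HasDerivAt (fun s : ℝ => Real.exp (-(t - s))) (Real.exp (-(t - r))) r :=
    fun r => by simpa using (((hasDerivAt_id r).const_sub (t : ℝ)).neg).exp
  have hint : ∫ s in (0 : ℝ)..t, Real.exp (-(t - s)) * 1 = 1 - Real.exp (-t) := by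
    simp_rw [mul_one]
    rw [intervalIntegral.integral_eq_sub_of_hasDerivAt (fun r _ => hd r)
      (Continuous.intervalIntegrable (by fun_prop) _ _)]
    simp
  have hlim := tendsto_sum_mul_sub t.coe_nonneg (f := fun s => Real.exp (-(t - s)))
    (g := fun s => s) (by fun_prop) hasDerivAt_id continuous_const (c := fun n k => t * k / n)
    (fun n k _ => ⟨le_rfl, by gcongr; exact k.le_succ⟩)
  rw [hint] at hlim
  simp_rw [charFun_map_ouSum hB t]
  have hv : 0 ≤ 1 - Real.exp (-(t : ℝ)) := by simp
  have hfin : charFun (gaussianReal 0 (1 - Real.exp (-t)).toNNReal) u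
      = Complex.exp (-(u ^ 2 / 2 * (1 - Real.exp (-t)) : ℝ)) := by
    rw [charFun_gaussianReal]
    congr 1
    rw [show (((1 - Real.exp (-t)).toNNReal : ℝ≥0) : ℂ) = ((1 - Real.exp (-t) : ℝ) : ℂ) by
      rw [← Complex.ofReal_inj.2 (Real.coe_toNNReal _ hv)]]
    push_cast
    ring
  rw [hfin]
  exact (Complex.continuous_exp.tendsto _).comp
    ((Complex.continuous_ofReal.tendsto _).comp (hlim.const_mul (u ^ 2 / 2))).neg

end Law

/-! ### The law of the channel components -/

/-- `channelDensity m η` is Mathlib's Gaussian density with variance `η ^ 2`. -/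
lemma hasDensity_iff_map_eq_gaussianReal {Ω : Type*} [MeasurableSpace Ω] {P : Measure Ω}
    {X : Ω → ℝ} (hX : AEMeasurable X P) (m : ℝ) {η : ℝ} (hη : 0 < η) :
    HasDensity X (channelDensity m η) P ↔ P.map X = gaussianReal m (η ^ 2).toNNReal := by
  have hpdf : channelDensity m η = gaussianPDFReal m (η ^ 2).toNNReal := by
    funext x
    rw [channelDensity, gaussianPDFReal, Real.coe_toNNReal _ (sq_nonneg η),
      Real.sqrt_mul (by positivity) (η ^ 2), Real.sqrt_sq hη.le, one_div, mul_comm η]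
  have hv : (η ^ 2).toNNReal ≠ 0 := (Real.toNNReal_pos.2 (by positivity)).ne'
  rw [gaussianReal_of_var_ne_zero _ hv, hpdf]
  exact ⟨fun h => h.2.2.2, fun h => ⟨hX, measurable_gaussianPDFReal _ _,
    gaussianPDFReal_nonneg _ _, h⟩⟩

lemma tendsto_exp_neg_half :
    Tendsto (fun t : ℝ≥0 => Real.exp (-(t : ℝ) / 2)) atTop (𝓝 0) := by
  refine Real.tendsto_exp_atBot.comp ?_
  simp_rw [neg_div]
  exact tendsto_neg_atTop_atBot.comp
    ((NNReal.tendsto_coe_atTop.2 tendsto_id).atTop_div_const two_pos)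

lemma tendsto_exp_neg : Tendsto (fun t : ℝ≥0 => Real.exp (-(t : ℝ))) atTop (𝓝 0) :=
  Real.tendsto_exp_atBot.comp
    (tendsto_neg_atTop_atBot.comp (NNReal.tendsto_coe_atTop.2 tendsto_id))

namespace IsChannelProcess

variable {Ω : Type*} [MeasurableSpace Ω] {P : Measure Ω} {μ : EuclideanSpace ℝ (Fin 2)} {η : ℝ}
  {W h : ℝ≥0 → Ω → EuclideanSpace ℝ (Fin 2)}

lemma measurable_apply (hh : IsChannelProcess μ η W h P) (t : ℝ≥0) (j : Fin 2) :
    Measurable fun ω => h t ω j := by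
  have := hh.measurable t
  fun_prop

/-- The explicit solution of the Ornstein–Uhlenbeck equation, coordinatewise. -/
lemma apply_ae_eq (hh : IsChannelProcess μ η W h P) (j : Fin 2) :
    ∀ᵐ ω ∂P, ∀ t : ℝ≥0, h t ω j
      = μ j + Real.exp (-t / 2) * (h 0 ω j - μ j) + η * ouNoise t (fun s => W s ω j) := by
  filter_upwards [hh.continuous_paths, hh.equation, (hh.wiener.brownian j).cont] with ω hc he hw
  refine eq_add_ouNoise_of_equation (x := fun t => h t ω j) (by fun_prop) hw fun t => ?_
  have hint : IntervalIntegrable (fun s : ℝ => (1 / 2 : ℝ) • (μ - h s.toNNReal ω)) volume 0 t :=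
    Continuous.intervalIntegrable (by fun_prop) _ _
  have hL := (EuclideanSpace.proj (𝕜 := ℝ) j).intervalIntegral_comp_comm hint
  have := congrArg (EuclideanSpace.proj (𝕜 := ℝ) j) (he t)
  rw [map_add, map_add, ← hL] at this
  simpa using this

/-- The noise is a limit of the sums `ouSum`, which are measurable functions of the path of `W`
for the product σ-algebra; so it inherits independence from the initial value. -/
lemma indepFun_ouNoise [IsProbabilityMeasure P] (hh : IsChannelProcess μ η W h P) (t : ℝ≥0)
    (j : Fin 2) :
    IndepFun (fun ω => h 0 ω j) (fun ω => ouNoise t (fun s => W s ω j)) P := by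
  -- a version of the noise that is a measurable function of the path
  let G : (ℝ≥0 → EuclideanSpace ℝ (Fin 2)) → ℝ := fun w =>
    limsup (fun n => ouSum t n (fun s => w s j)) atTop
  have hG : Measurable G := .limsup fun n => (measurable_ouSum t n).comp (by fun_prop)
  have hind : IndepFun (fun ω => h 0 ω j) (fun ω => G (fun s => W s ω)) P :=
    hh.indep_init.comp (φ := fun x : EuclideanSpace ℝ (Fin 2) => x j) (by fun_prop) hG
  refine hind.congr (ae_eq_refl _) ?_
  filter_upwards [ae_tendsto_ouSum (hh.wiener.brownian j) t] with ω hω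
  exact hω.limsup_eq

/-- Each component is the sum of the relaxed initial value and of the scaled noise; the two summands
are independent by `indepFun_initial_noise`. -/
lemma apply_ae_eq_add (hh : IsChannelProcess μ η W h P) (t : ℝ≥0) (j : Fin 2) :
    (fun ω => h t ω j) =ᵐ[P] (fun ω => μ j + Real.exp (-t / 2) * (h 0 ω j - μ j))
      + fun ω => η * ouNoise t (fun s => W s ω j) := by
  filter_upwards [hh.apply_ae_eq j] with ω hω using hω t

lemma indepFun_initial_noise [IsProbabilityMeasure P] (hh : IsChannelProcess μ η W h P)
    (t : ℝ≥0) (j : Fin 2) :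
    IndepFun (fun ω => μ j + Real.exp (-t / 2) * (h 0 ω j - μ j))
      (fun ω => η * ouNoise t (fun s => W s ω j)) P :=
  (hh.indepFun_ouNoise t j).comp (φ := fun x => μ j + Real.exp (-t / 2) * (x - μ j))
    (ψ := fun x => η * x) (by fun_prop) (by fun_prop)

lemma hasLaw_noise [IsProbabilityMeasure P] (hh : IsChannelProcess μ η W h P)
    (t : ℝ≥0) (j : Fin 2) :
    HasLaw (fun ω => η * ouNoise t (fun s => W s ω j))
      (gaussianReal 0 (η ^ 2 * (1 - Real.exp (-t))).toNNReal) P := by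
  convert! gaussianReal_const_mul (hasLaw_ouNoise (hh.wiener.brownian j) t) η using 2
  · simp
  · rw [Real.toNNReal_mul (sq_nonneg η), Real.toNNReal_of_nonneg (sq_nonneg η)]

/-! ### Moments -/

section Moments

variable [IsProbabilityMeasure P]

lemma memLp_relaxed (h0 : MemLp (h 0) 2 P) (t : ℝ≥0) (j : Fin 2) :
    MemLp (fun ω => μ j + Real.exp (-t / 2) * (h 0 ω j - μ j)) 2 P := by
  have h1 : MemLp (fun ω => h 0 ω j - μ j) 2 P := (h0.eval_piLp j).sub (memLp_const _)
  exact (memLp_const (μ j)).add (h1.const_mul _)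

lemma memLp_apply (hh : IsChannelProcess μ η W h P) (h0 : MemLp (h 0) 2 P) (t : ℝ≥0)
    (j : Fin 2) : MemLp (fun ω => h t ω j) 2 P :=
  ((memLp_relaxed h0 t j).add (hh.hasLaw_noise t j).hasGaussianLaw.memLp_two).ae_eq
    (hh.apply_ae_eq_add t j).symm

lemma integral_apply (hh : IsChannelProcess μ η W h P) (h0 : MemLp (h 0) 2 P) (t : ℝ≥0)
    (j : Fin 2) :
    ∫ ω, h t ω j ∂P = μ j + Real.exp (-t / 2) * (∫ ω, h 0 ω j ∂P - μ j) := by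
  have hi : Integrable (fun ω => h 0 ω j) P := (h0.eval_piLp j).integrable one_le_two
  have hn := hh.hasLaw_noise t j
  have h1 : Integrable (fun ω => Real.exp (-t / 2) * (h 0 ω j - μ j)) P :=
    (hi.sub (integrable_const (μ j))).const_mul _
  rw [integral_congr_ae (hh.apply_ae_eq_add t j),
    integral_add' ((memLp_relaxed h0 t j).integrable one_le_two) hn.hasGaussianLaw.integrable,
    integral_add (integrable_const (μ j)) h1, integral_const_mul,
    integral_sub hi (integrable_const _), hn.integral_eq, integral_id_gaussianReal]
  simp

lemma variance_apply (hh : IsChannelProcess μ η W h P) (h0 : MemLp (h 0) 2 P) (t : ℝ≥0)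
    (j : Fin 2) :
    Var[fun ω => h t ω j; P]
      = Real.exp (-t / 2) ^ 2 * Var[fun ω => h 0 ω j; P] + η ^ 2 * (1 - Real.exp (-t)) := by
  have hj := h0.eval_piLp j
  have hn := hh.hasLaw_noise t j
  have h1 : AEStronglyMeasurable (fun ω => Real.exp (-t / 2) * (h 0 ω j - μ j)) P :=
    (hj.1.sub aestronglyMeasurable_const).const_mul _
  rw [variance_congr (hh.apply_ae_eq_add t j),
    (hh.indepFun_initial_noise t j).variance_add (memLp_relaxed h0 t j)
      hn.hasGaussianLaw.memLp_two,
    variance_const_add h1, variance_const_mul, variance_sub_const hj.1, hn.variance_eq,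
    variance_id_gaussianReal, Real.coe_toNNReal]
  exact mul_nonneg (sq_nonneg _) (by simp)

lemma sq_norm_moment_sub (hh : IsChannelProcess μ η W h P) (h0 : MemLp (h 0) 2 P) (t : ℝ≥0) :
    (∫ ω, ‖h t ω‖ ^ 2 ∂P) - ‖∫ ω, h t ω ∂P‖ ^ 2 = ∑ j, Var[fun ω => h t ω j; P] := by
  have hm := fun j => hh.memLp_apply h0 t j
  simp_rw [EuclideanSpace.real_norm_sq_eq]
  rw [integral_finsetSum _ fun j _ => (hm j).integrable_sq, ← Finset.sum_sub_distrib]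
  refine Finset.sum_congr rfl fun j _ => ?_
  rw [eval_integral_piLp fun i => (hm i).integrable one_le_two, variance_eq_sub (hm j)]
  rfl

end Moments

/-! ### Stationary laws -/

section Stationary

variable [IsProbabilityMeasure P]

lemma map_apply_eq_gaussianReal_of_init (hh : IsChannelProcess μ η W h P) {j : Fin 2}
    (h0 : P.map (fun ω => h 0 ω j) = gaussianReal (μ j) (η ^ 2).toNNReal) (t : ℝ≥0) :
    P.map (fun ω => h t ω j) = gaussianReal (μ j) (η ^ 2).toNNReal := by
  have hl : HasLaw (fun ω => h 0 ω j) (gaussianReal (μ j) (η ^ 2).toNNReal) P :=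
    ⟨(hh.measurable_apply 0 j).aemeasurable, h0⟩
  have hl' := gaussianReal_const_add
    (gaussianReal_const_mul (gaussianReal_sub_const hl (μ j)) (Real.exp (-t / 2))) (μ j)
  rw [Measure.map_congr (hh.apply_ae_eq_add t j), gaussianReal_add_gaussianReal_of_indepFun
    (hh.indepFun_initial_noise t j) hl'.map_eq (hh.hasLaw_noise t j).map_eq]
  congr 1
  · simp
  · have hexp : Real.exp (-(t : ℝ)) = Real.exp (-t / 2) ^ 2 := by
      rw [← Real.exp_nat_mul]; congr 1; push_cast; ring
    have h1 : Real.exp (-(t : ℝ)) ≤ 1 := by simp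
    rw [← NNReal.coe_inj]
    push_cast
    rw [Real.coe_toNNReal _ (sq_nonneg η), Real.coe_toNNReal _ (mul_nonneg (sq_nonneg η)
      (by linarith)), hexp]
    ring

/-- As `t → ∞` the initial value is forgotten, so a law that does not depend on time is the limit
law of the noise, shifted by the mean. -/
lemma map_init_eq_gaussianReal_of_stationary (hh : IsChannelProcess μ η W h P) {j : Fin 2}
    (hst : ∀ t, P.map (fun ω => h t ω j) = P.map (fun ω => h 0 ω j)) :
    P.map (fun ω => h 0 ω j) = gaussianReal (μ j) (η ^ 2).toNNReal := by
  have hm := hh.measurable_apply 0 j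
  have := Measure.isProbabilityMeasure_map (μ := P) hm.aemeasurable
  refine Measure.ext_of_charFun (funext fun u => ?_)
  have hX : ∀ t : ℝ≥0, AEMeasurable (fun ω => μ j + Real.exp (-t / 2) * (h 0 ω j - μ j)) P :=
    fun t => (((hm.sub_const _).const_mul _).const_add _).aemeasurable
  have hfac : ∀ t : ℝ≥0, charFun (P.map fun ω => h 0 ω j) u
      = charFun (P.map fun ω => μ j + Real.exp (-t / 2) * (h 0 ω j - μ j)) u
        * charFun (gaussianReal 0 (η ^ 2 * (1 - Real.exp (-t))).toNNReal) u := fun t => by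
    rw [← hst t, Measure.map_congr (hh.apply_ae_eq_add t j),
      (hh.indepFun_initial_noise t j).charFun_map_add_eq_mul (hX t)
        (hh.hasLaw_noise t j).aemeasurable, Pi.mul_apply, (hh.hasLaw_noise t j).map_eq]
  have hlim1 := tendsto_charFun_map_of_ae_tendsto (l := atTop) hX
    (aemeasurable_const (b := μ j)) (ae_of_all P fun ω => by
      simpa using (tendsto_exp_neg_half.mul_const (h 0 ω j - μ j)).const_add (μ j)) u
  have hlim2 : Tendsto
      (fun t : ℝ≥0 => charFun (gaussianReal 0 (η ^ 2 * (1 - Real.exp (-t))).toNNReal) u) atTop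
      (𝓝 (charFun (gaussianReal 0 (η ^ 2).toNNReal) u)) := by
    have hv : Tendsto (fun t : ℝ≥0 => (η ^ 2 * (1 - Real.exp (-t))).toNNReal) atTop
        (𝓝 (η ^ 2).toNNReal) := by
      simpa using tendsto_real_toNNReal ((tendsto_exp_neg.const_sub 1).const_mul (η ^ 2))
    have hc : Continuous fun v : ℝ≥0 => charFun (gaussianReal 0 v) u := by
      simp_rw [charFun_gaussianReal]
      have : Continuous fun v : ℝ≥0 => ((v : ℝ) : ℂ) := by fun_prop
      exact Complex.continuous_exp.comp
        (continuous_const.sub ((this.mul continuous_const).div_const _))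
    exact (hc.tendsto _).comp hv
  have hlim := hlim1.mul hlim2
  simp_rw [← hfac] at hlim
  rw [tendsto_nhds_unique tendsto_const_nhds hlim, Measure.map_const, measure_univ, one_smul,
    charFun_dirac, charFun_gaussianReal, charFun_gaussianReal, ← Complex.exp_add]
  congr 1
  simp
  ring

end Stationary

end IsChannelProcess

theorem proposition1 {Ω : Type*} [MeasurableSpace Ω] (P : Measure Ω) [IsProbabilityMeasure P]
    (μ : EuclideanSpace ℝ (Fin 2)) (η : ℝ) (hη : 0 ≤ η)
    (W h : ℝ≥0 → Ω → EuclideanSpace ℝ (Fin 2)) (hh : IsChannelProcess μ η W h P) :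
    -- moments, for a square-integrable (for example deterministic) initial value
    (MemLp (h 0) 2 P →
      (∀ t, MemLp (h t) 2 P) ∧
      Tendsto (fun t => ∫ ω, h t ω ∂P) atTop (𝓝 μ) ∧
      Tendsto (fun t => (∫ ω, ‖h t ω‖ ^ 2 ∂P) - ‖∫ ω, h t ω ∂P‖ ^ 2) atTop (𝓝 (2 * η ^ 2))) ∧
    -- stationary densities: started from the Gaussian density, each component keeps it,
    -- and no other law of the component is invariant in time
    (0 < η → ∀ j : Fin 2,
      (HasDensity (fun ω => h 0 ω j) (channelDensity (μ j) η) P →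
        ∀ t, HasDensity (fun ω => h t ω j) (channelDensity (μ j) η) P) ∧
      ((∀ t, P.map (fun ω => h t ω j) = P.map (fun ω => h 0 ω j)) →
        HasDensity (fun ω => h 0 ω j) (channelDensity (μ j) η) P)) := by
  refine ⟨fun h0 => ⟨fun t => .of_eval_piLp fun j => hh.memLp_apply h0 t j, ?_, ?_⟩,
    fun hpos j => ⟨fun hd t => ?_, fun hst => ?_⟩⟩
  · have hlim : ∀ j, Tendsto (fun t => ∫ ω, h t ω j ∂P) atTop (𝓝 (μ j)) := fun j => by
      refine Tendsto.congr (fun t => (hh.integral_apply h0 t j).symm) ?_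
      simpa using (tendsto_exp_neg_half.mul_const
        (∫ ω, h 0 ω j ∂P - μ j)).const_add (μ j)
    have hpi : Tendsto (fun t j => (∫ ω, h t ω ∂P) j) atTop (𝓝 fun j => μ j) := by
      refine tendsto_pi_nhds.2 fun j => (hlim j).congr fun t => ?_
      exact (eval_integral_piLp (fun i => (hh.memLp_apply h0 t i).integrable one_le_two) j).symm
    exact ((PiLp.continuous_toLp 2 _).tendsto _).comp hpi
  · have hlim : ∀ j, Tendsto (fun t : ℝ≥0 => Real.exp (-t / 2) ^ 2 * Var[fun ω => h 0 ω j; P]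
        + η ^ 2 * (1 - Real.exp (-t))) atTop (𝓝 (η ^ 2)) := fun j => by
      simpa using ((tendsto_exp_neg_half.pow 2).mul_const
        Var[fun ω => h 0 ω j; P]).add
          ((tendsto_exp_neg.const_sub 1).const_mul (η ^ 2))
    refine Tendsto.congr (fun t => ((hh.sq_norm_moment_sub h0 t).trans
      (Finset.sum_congr rfl fun j _ => hh.variance_apply h0 t j)).symm) ?_
    simpa using tendsto_finsetSum Finset.univ fun j _ => hlim j
  · rw [hasDensity_iff_map_eq_gaussianReal (hh.measurable_apply _ j).aemeasurable _ hpos] at hd ⊢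
    exact hh.map_apply_eq_gaussianReal_of_init hd t
  · rw [hasDensity_iff_map_eq_gaussianReal (hh.measurable_apply 0 j).aemeasurable _ hpos]
    exact hh.map_init_eq_gaussianReal_of_stationary hst
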